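/- Let $\mathbb A=(A;R_1,\dots,R_n)$ be a finite relational structure with finitely many relations $R_i\subseteq A^{k_i}$, all of them nonempty, and let $\Sigma$ be a set of identities (pairs $u\approx v$ of terms) in some, possibly infinite, signature of finitary operation symbols. Write $\mathbb B\models\Sigma$ if the operation symbols can be interpreted by polymorphisms of $\mathbb B$ (operations preserving all relations of $\mathbb B$) so that all identities of $\Sigma$ hold universally in $\mathbb B$. A digraph is regarded as a structure with one binary relation, its edge relation. The digraph $\mathcal D(\mathbb A)$ is defined as follows. Let $k=\sum_i k_i$ and let $R=R_1\times\dots\times R_n\subseteq A^k$. For $\mathcal I\subseteq\{1,\dots,k\}$ let $\mathbb Q_{\mathcal I}$ be the oriented path obtained by concatenating, in this order, a single edge $\bullet\to\bullet$, the paths $\mathbb Q_{\mathcal I,1},\dots,\mathbb Q_{\mathcal I,k}$, and a single edge $\bullet\to\bullet$, where $\mathbb Q_{\mathcal I,l}$ is a single edge $\bullet\to\bullet$ if $l\in\mathcal I$ and a zigzag $\bullet\to\bullet\leftarrow\bullet\to\bullet$ if $l\notin\mathcal I$. Then $\mathcal D(\mathbb A)$ is obtained from the digraph with vertex set the disjoint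 union $A\sqcup R$ and edge set $A\times R$ by replacing every edge $(a,\mathbf r)$ by a copy of the path $\mathbb Q_{\{i\,\mid\,a=r_i\}}$, its initial vertex being identified with $a$, its terminal vertex with $\mathbf r$, and its inner vertices being new. Assume that 1. every identity in $\Sigma$ is linear, i.e. each of its two sides contains at most one occurrence of an operation symbol; 2. $\Sigma$ is idempotent, i.e. for each operation symbol $f$ that appears in $\Sigma$, the identity $f(x,\dots,x)\approx x$ is in $\Sigma$; 3. the zigzag $\bullet\to\bullet\leftarrow\bullet\to\bullet$ satisfies $\Sigma$, i.e. (zigzag) $\models\Sigma$; 4. each identity $u\approx v$ in $\Sigma$ is balanced (the same variables occur in $u$ and in $v$) or contains at most two variables. Then $\mathbb A\models\Sigma$ if and only if $\mathcal D(\mathbb A)\models\Sigma$. -/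

import Mathlib

universe u v w

namespace DigraphReduction

/-- A relational structure `(A; R₁, …, Rₙ)` with domain `A`: finitely many relations, the `i`-th one
of arity `arity i`. -/
structure RelStructure (A : Type u) where
  /-- the number `n` of relations -/
  numRel : ℕ
  /-- the arities `k₁, …, kₙ` -/
  arity : Fin numRel → ℕ
  /-- the relations `R₁, …, Rₙ` -/
  rel : (i : Fin numRel) → Set (Fin (arity i) → A)

/-- The operation `f` on `A` preserves the relation `R`: applying `f` coordinatewise to tuples
of `R` gives a tuple of `R`. -/
def Preserves {A : Type u} {m k : ℕ} (f : (Fin m → A) → A) (R : Set (Fin k → A)) : Prop :=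
  ∀ a : Fin m → Fin k → A, (∀ i, a i ∈ R) → (fun j => f (fun i => a i j)) ∈ R

/-- `f` is a polymorphism of `𝔸`: it preserves all the relations of `𝔸`. -/
def RelStructure.IsPolymorphism {A : Type u} (𝔸 : RelStructure A) {m : ℕ}
    (f : (Fin m → A) → A) : Prop :=
  ∀ i, Preserves f (𝔸.rel i)

/-- A digraph is a relational structure whose only relation is the binary edge relation. -/
def digraphStructure {V : Type u} (G : Digraph V) : RelStructure V where
  numRel := 1
  arity := fun _ => 2
  rel := fun _ => {p | G.Adj (p 0) (p 1)}

/-! ### Identities -/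

section Identities

variable {L : FirstOrder.Language.{v, w}}

/-- An identity `s ≈ t` between terms over the variables `x₀, x₁, x₂, …`. -/
abbrev Identity (L : FirstOrder.Language.{v, w}) : Type v := L.Term ℕ × L.Term ℕ

/-- The number of occurrences of operation symbols in a term. -/
def opCount : L.Term ℕ → ℕ
  | .var _ => 0
  | .func _ ts => 1 + ∑ i, opCount (ts i)

/-- The set of operation symbols (together with their arities) that occur in a term. -/
def opSymbols : L.Term ℕ → Set (Σ m, L.Functions m)
  | .var _ => ∅
  | .func f ts => {⟨_, f⟩} ∪ ⋃ i, opSymbols (ts i)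

/-- Each side has at most one occurrence of an operation symbol. -/
def IsLinear (e : Identity L) : Prop := opCount e.1 ≤ 1 ∧ opCount e.2 ≤ 1

/-- The same variables occur on both sides. -/
def IsBalanced (e : Identity L) : Prop := e.1.varFinset = e.2.varFinset

/-- At most two variables occur in the identity. -/
def AtMostTwoVariables (e : Identity L) : Prop := (e.1.varFinset ∪ e.2.varFinset).card ≤ 2

/-- For each operation symbol `f` that appears in `S`, the identity `f(x, …, x) ≈ x` is in `S`,
for some variable `x`. -/
def IsIdempotentSet (S : Set (Identity L)) : Prop :=
  ∀ e ∈ S, ∀ f ∈ opSymbols e.1 ∪ opSymbols e.2,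
    ∃ x : ℕ, ((.func f.2 (fun _ => .var x), .var x) : Identity L) ∈ S

/-- `𝔸 ⊨ S`: the operation symbols can be interpreted by polymorphisms of `𝔸` in such a way that
all identities of `S` hold universally. -/
def RelStructure.Satisfies {A : Type u} (𝔸 : RelStructure A) (S : Set (Identity L)) : Prop :=
  ∃ F : L.Structure A, (∀ (m : ℕ) (f : L.Functions m), 𝔸.IsPolymorphism (F.funMap f)) ∧
    ∀ e ∈ S, ∀ x : ℕ → A, e.1.realize x = e.2.realize x

end Identities

/-! ### The zigzag -/

/-- The zigzag `0 → 1 ← 2 → 3`. -/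
def zigzag : Digraph (Fin 4) where
  Adj x y := (x = 0 ∧ y = 1) ∨ (x = 2 ∧ y = 1) ∨ (x = 2 ∧ y = 3)

/-! ### The oriented paths `ℚ_I` and the digraph `𝒟(𝔸)` -/

/-- The inner vertices of the oriented path `ℚ_I`, the concatenation of a single edge, the segments
`ℚ_{I,0}, …, ℚ_{I,k-1}`, and a single edge, where `ℚ_{I,l}` is a single edge if `l ∈ I` and a
zigzag if `l ∉ I`. -/
inductive PathInner {k : ℕ} (I : Set (Fin k)) : Type
  /-- `joint j`, for `j < k`, is the initial vertex of `ℚ_{I,j}`; for `0 < j` it is also the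
  terminal vertex of `ℚ_{I,j-1}`. The vertex `joint k` is the initial vertex of the last edge. -/
  | joint (j : Fin (k + 1))
  /-- the second vertex of the zigzag `• → peak ← valley → •` that is the segment `ℚ_{I,l}` -/
  | peak (l : Fin k) (h : l ∉ I)
  /-- the third vertex of the zigzag `• → peak ← valley → •` that is the segment `ℚ_{I,l}` -/
  | valley (l : Fin k) (h : l ∉ I)

/-- The vertices of the oriented path `ℚ_I`. -/
inductive PathVertex {k : ℕ} (I : Set (Fin k)) : Type
  | initial
  | terminal
  | inner (p : PathInner I)

/-- The edges of the oriented path `ℚ_I`. -/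
inductive PathEdge {k : ℕ} (I : Set (Fin k)) : PathVertex I → PathVertex I → Prop
  /-- the first single edge -/
  | first : PathEdge I .initial (.inner (.joint 0))
  /-- the segment `ℚ_{I,l}` when it is a single edge -/
  | single (l : Fin k) (h : l ∈ I) :
      PathEdge I (.inner (.joint l.castSucc)) (.inner (.joint l.succ))
  /-- the first edge of a zigzag `ℚ_{I,l}` -/
  | zigzag₁ (l : Fin k) (h : l ∉ I) : PathEdge I (.inner (.joint l.castSucc)) (.inner (.peak l h))
  /-- the second edge of a zigzag `ℚ_{I,l}`, traversed backwards by the path -/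
  | zigzag₂ (l : Fin k) (h : l ∉ I) : PathEdge I (.inner (.valley l h)) (.inner (.peak l h))
  /-- the third edge of a zigzag `ℚ_{I,l}` -/
  | zigzag₃ (l : Fin k) (h : l ∉ I) : PathEdge I (.inner (.valley l h)) (.inner (.joint l.succ))
  /-- the last single edge -/
  | last : PathEdge I (.inner (.joint (Fin.last k))) .terminal

/-- The oriented path `ℚ_I`. -/
def pathDigraph {k : ℕ} (I : Set (Fin k)) : Digraph (PathVertex I) where
  Adj := PathEdge I

/-- The arity `k = k₁ + ⋯ + kₙ`. -/
abbrev RelStructure.totalArity {A : Type u} (𝔸 : RelStructure A) : ℕ := ∑ i, 𝔸.arity i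

/-- The `k`-ary relation `R = R₁ × ⋯ × Rₙ`: a `k`-tuple belongs to it if its `i`-th block of `kᵢ`
consecutive entries belongs to `Rᵢ`, for every `i`. -/
def RelStructure.prodRel {A : Type u} (𝔸 : RelStructure A) : Set (Fin 𝔸.totalArity → A) :=
  {r | ∀ i, (fun j => r (finSigmaFinEquiv ⟨i, j⟩)) ∈ 𝔸.rel i}

/-- The set of coordinates at which the tuple `r` has the entry `a`. -/
def coordSet {A : Type u} {k : ℕ} (a : A) (r : Fin k → A) : Set (Fin k) := {i | a = r i}

/-- The vertices of `𝒟(𝔸)`: the elements of `A`, the tuples of `R`, and for each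
`e = (a, r) ∈ A × R` the inner vertices of the path `ℙ_e = ℚ_{{i | a = r i}}`. -/
inductive DVertex {A : Type u} (𝔸 : RelStructure A) : Type u
  | elem (a : A)
  | tuple (r : 𝔸.prodRel)
  | inner (a : A) (r : 𝔸.prodRel) (p : PathInner (coordSet a r.1))

/-- The path `ℙ_e`, `e = (a, r)`, inside `𝒟(𝔸)`: its initial vertex is identified with `a`, its
terminal vertex with `r`. -/
def DVertex.ofPath {A : Type u} {𝔸 : RelStructure A} (a : A) (r : 𝔸.prodRel) :
    PathVertex (coordSet a r.1) → DVertex 𝔸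
  | .initial => .elem a
  | .terminal => .tuple r
  | .inner p => .inner a r p

/-- The digraph `𝒟(𝔸)`, obtained from the digraph `(A ∪ R; A × R)` by replacing every edge
`e = (a, r)` by the oriented path `ℙ_e`. -/
def RelStructure.toDigraph {A : Type u} (𝔸 : RelStructure A) : Digraph (DVertex 𝔸) where
  Adj x y := ∃ (a : A) (r : 𝔸.prodRel) (p q : PathVertex (coordSet a r.1)),
    (pathDigraph (coordSet a r.1)).Adj p q ∧ x = DVertex.ofPath a r p ∧ y = DVertex.ofPath a r q

end DigraphReduction

namespace DigraphReduction

/-! ### Coordinates on the vertices of `𝒟(𝔸)` -/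

section Coordinates

variable {A : Type u} {𝔸 : RelStructure A}

/-! A vertex of `𝒟(𝔸)` is described by an element, a tuple, a level and a kind (peak, joint,
valley). In these terms (`adj_iff`) an edge raises the level by one, keeps element and tuple except
at the two ends, and joins joint to joint only across a single-edge segment or at the ends.

From `𝒟(𝔸)` to `𝔸`: every path is a level-preserving image of the path all of whose segments are
zigzags. A polymorphism therefore maps the paths of pairs `(a i, r i)` to a walk that climbs one
path from bottom to top, and a segment single in all of them is single in the image
(`polymorphism_elem_tuple`). So polymorphisms restrict to `A`, and all identities are inherited.

From `𝔸` to `𝒟(𝔸)`: combine an idempotent polymorphism `f` of `𝔸` with one of the zigzag; the latter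
acts on the sources `{0, 2}` and on the sinks `{1, 3}` as Boolean operations `low` and `high`. On
entries of equal level, `f` gives element and tuple, and `low`, `high` give the kind. On unequal
levels, `low` chooses between the highest and the lowest entries and a fixed linear order picks one
of them. Edges are preserved (`adj_extend`). The value depends only on the set of entries and on
values of `f`, `low`, `high`, so balanced linear identities transfer (`extend_eq_of_range_eq`). An
unbalanced one in at most two variables says, by idempotence, that an operation returns `x` on some
arrangement of `x` and `y`; this transfers by `extend_eq_of_subset_pair`. -/

/-- The `j`-th segment of the path `ℙ_{(a, r)}` is a single edge. -/
def IsSingle (a : A) (r : 𝔸.prodRel) (j : ℕ) : Prop :=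
  ∃ h : j < 𝔸.totalArity, a = r.1 ⟨j, h⟩

/-- The level of a vertex: the height above the elements of `A`. -/
def DVertex.lvl : DVertex 𝔸 → ℕ
  | .elem _ => 0
  | .tuple _ => 𝔸.totalArity + 2
  | .inner _ _ (.joint j) => j + 1
  | .inner _ _ (.peak l _) => l + 2
  | .inner _ _ (.valley l _) => l + 1

/-- The kind of a vertex: `0` for peaks, `2` for valleys, `1` for all the others. -/
def DVertex.kind : DVertex 𝔸 → Fin 3
  | .inner _ _ (.peak _ _) => 0
  | .inner _ _ (.valley _ _) => 2
  | _ => 1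

/-- The element `a` on whose path the vertex lies, with a default value for tuples. -/
def DVertex.projA [Inhabited A] : DVertex 𝔸 → A
  | .elem a => a
  | .tuple _ => default
  | .inner a _ _ => a

/-- The tuple `r` on whose path the vertex lies, with a default value for elements. -/
def DVertex.projR [Inhabited 𝔸.prodRel] : DVertex 𝔸 → 𝔸.prodRel
  | .elem _ => default
  | .tuple r => r
  | .inner _ r _ => r

open Classical in
/-- The vertex of the path `ℙ_{(a, r)}` of the given level and kind. Peaks and valleys that do not
exist are replaced by the joint of the same level. -/
noncomputable def mkV (a : A) (r : 𝔸.prodRel) (lev : ℕ) (c : Fin 3) : DVertex 𝔸 :=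
  if _h0 : lev = 0 then .elem a
  else if hl : lev ≤ 𝔸.totalArity + 1 then
    if hv : c = 2 ∧ lev - 1 < 𝔸.totalArity ∧ ¬ IsSingle a r (lev - 1) then
      .inner a r (.valley ⟨lev - 1, hv.2.1⟩ fun h => hv.2.2 ⟨hv.2.1, h⟩)
    else if hp : c = 0 ∧ 2 ≤ lev ∧ ¬ IsSingle a r (lev - 2) then
      .inner a r (.peak ⟨lev - 2, by omega⟩ fun h => hp.2.2 ⟨by omega, h⟩)
    else .inner a r (.joint ⟨lev - 1, by omega⟩)
  else .tuple r

theorem mkV_zero (a : A) (r : 𝔸.prodRel) (c : Fin 3) : mkV a r 0 c = .elem a := by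
  simp [mkV]

theorem mkV_top (a : A) (r : 𝔸.prodRel) (c : Fin 3) :
    mkV a r (𝔸.totalArity + 2) c = .tuple r := by
  simp [mkV]

theorem mkV_joint (a : A) (r : 𝔸.prodRel) (j : Fin (𝔸.totalArity + 1)) :
    mkV a r (j + 1) 1 = .inner a r (.joint j) := by
  have := j.2
  simp [mkV, show (j : ℕ) ≤ 𝔸.totalArity by omega]

theorem mkV_valley (a : A) (r : 𝔸.prodRel) (l : Fin 𝔸.totalArity) (h : l ∉ coordSet a r.1) :
    mkV a r (l + 1) 2 = .inner a r (.valley l h) := by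
  have := l.2
  have h' : ¬ IsSingle a r l := fun ⟨_, e⟩ => h e
  simp [mkV, show (l : ℕ) ≤ 𝔸.totalArity by omega, h']

theorem mkV_peak (a : A) (r : 𝔸.prodRel) (l : Fin 𝔸.totalArity) (h : l ∉ coordSet a r.1) :
    mkV a r (l + 2) 0 = .inner a r (.peak l h) := by
  have := l.2
  have h' : ¬ IsSingle a r l := fun ⟨_, e⟩ => h e
  simp [mkV, show (l : ℕ) + 1 ≤ 𝔸.totalArity by omega, h']

theorem mkV_valley_of_isSingle (a : A) (r : 𝔸.prodRel) (j : ℕ)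
    (h : j < 𝔸.totalArity → IsSingle a r j) : mkV a r (j + 1) 2 = mkV a r (j + 1) 1 := by
  by_cases hj : j < 𝔸.totalArity
  · simp [mkV, h hj]
  · simp [mkV, hj]

theorem mkV_peak_of_isSingle (a : A) (r : 𝔸.prodRel) (j : ℕ)
    (h : IsSingle a r j) : mkV a r (j + 2) 0 = mkV a r (j + 2) 1 := by
  simp [mkV, h]

theorem mkV_one_peak (a : A) (r : 𝔸.prodRel) : mkV a r 1 0 = mkV a r 1 1 := by
  simp [mkV]

theorem DVertex.lvl_le (x : DVertex 𝔸) : x.lvl ≤ 𝔸.totalArity + 2 := by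
  rcases x with _ | _ | ⟨_, _, j | l | l⟩ <;> simp only [lvl] <;> omega

theorem DVertex.eq_elem_of_lvl {x : DVertex 𝔸} (h : x.lvl = 0) : ∃ a, x = .elem a := by
  rcases x with a | _ | ⟨_, _, j | l | l⟩ <;> simp [lvl] at h ⊢

theorem DVertex.eq_mkV [Inhabited A] [Inhabited 𝔸.prodRel] (x : DVertex 𝔸) :
    x = mkV x.projA x.projR x.lvl x.kind := by
  rcases x with a | r | ⟨a, r, j | ⟨l, h⟩ | ⟨l, h⟩⟩
  · exact (mkV_zero _ _ _).symm
  · exact (mkV_top _ _ _).symm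
  · exact (mkV_joint _ _ _).symm
  · exact (mkV_peak _ _ _ h).symm
  · exact (mkV_valley _ _ _ h).symm

theorem two_le_lvl_of_kind_eq_zero {x : DVertex 𝔸} (h : x.kind = 0) : 2 ≤ x.lvl := by
  rcases x with a | r | ⟨a, r, j | ⟨l, h'⟩ | ⟨l, h'⟩⟩ <;> simp [DVertex.kind, DVertex.lvl] at h ⊢

theorem lvl_le_of_kind_eq_two {x : DVertex 𝔸} (h : x.kind = 2) :
    1 ≤ x.lvl ∧ x.lvl ≤ 𝔸.totalArity := by
  rcases x with a | r | ⟨a, r, j | ⟨l, h'⟩ | ⟨l, h'⟩⟩ <;> simp [DVertex.kind, DVertex.lvl] at h ⊢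

/-- Since missing peaks and valleys fall back to joints, each path is treated as if all its segments
were zigzags; only joint-to-joint edges depend on `a` and `r`. -/
theorem adj_mkV (a : A) (r : 𝔸.prodRel) (lev : ℕ) (c c' : Fin 3)
    (hlev : lev ≤ 𝔸.totalArity + 1) (hc : c ≠ 0) (hc' : c' ≠ 2)
    (h : c = 1 → c' = 1 → lev = 0 ∨ lev = 𝔸.totalArity + 1 ∨ IsSingle a r (lev - 1)) :
    𝔸.toDigraph.Adj (mkV a r lev c) (mkV a r (lev + 1) c') := by
  have hc : c = 1 ∨ c = 2 := by omega
  have hc' : c' = 0 ∨ c' = 1 := by omega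
  obtain rfl | ⟨j, rfl⟩ : lev = 0 ∨ ∃ j, lev = j + 1 := by
    cases lev <;> simp
  · have e : mkV a r (0 + 1) c' = .inner a r (.joint 0) := by
      rw [← mkV_joint]
      rcases hc' with rfl | rfl
      · exact mkV_one_peak a r
      · rfl
    rw [e, mkV_zero]
    exact ⟨a, r, _, _, .first, rfl, rfl⟩
  · by_cases hj : j = 𝔸.totalArity
    · subst hj
      have e : mkV a r (𝔸.totalArity + 1) c = .inner a r (.joint (Fin.last _)) := by
        rw [← mkV_joint]
        rcases hc with rfl | rfl
        · rfl
        · exact mkV_valley_of_isSingle a r _ fun h => absurd h (lt_irrefl _)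
      rw [e, mkV_top]
      exact ⟨a, r, _, _, .last, rfl, rfl⟩
    · have hj : j < 𝔸.totalArity := by omega
      have eA := mkV_joint a r (Fin.castSucc ⟨j, hj⟩)
      have eB := mkV_joint a r (Fin.succ ⟨j, hj⟩)
      simp only [Fin.val_castSucc, Fin.val_succ] at eA eB
      by_cases hs : IsSingle a r j
      · have e₁ : mkV a r (j + 1) c = mkV a r (j + 1) 1 := by
          rcases hc with rfl | rfl
          · rfl
          · exact mkV_valley_of_isSingle a r _ fun _ => hs
        have e₂ : mkV a r (j + 1 + 1) c' = mkV a r (j + 1 + 1) 1 := by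
          rcases hc' with rfl | rfl
          · exact mkV_peak_of_isSingle a r _ hs
          · rfl
        rw [e₁, e₂, eA, eB]
        exact ⟨a, r, _, _, .single ⟨j, hj⟩ hs.snd, rfl, rfl⟩
      · have hs' : (⟨j, hj⟩ : Fin _) ∉ coordSet a r.1 := fun h => hs ⟨hj, h⟩
        have eV := mkV_valley a r _ hs'
        have eP := mkV_peak a r _ hs'
        rcases hc with rfl | rfl <;> rcases hc' with rfl | rfl
        · rw [eA, eP]
          exact ⟨a, r, _, _, .zigzag₁ _ hs', rfl, rfl⟩
        · rcases h rfl rfl with h | h | h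
          · omega
          · omega
          · exact absurd h hs
        · rw [eV, eP]
          exact ⟨a, r, _, _, .zigzag₂ _ hs', rfl, rfl⟩
        · rw [eV, eB]
          exact ⟨a, r, _, _, .zigzag₃ _ hs', rfl, rfl⟩

/-- A vertex at level 0 forgets its tuple and one at the top forgets its element, so no agreement is
required there. -/
theorem adj_mkV_of_eq {a a' : A} {r r' : 𝔸.prodRel} {lev : ℕ} {c c' : Fin 3}
    (hlev : lev ≤ 𝔸.totalArity + 1) (hr : lev ≠ 0 → r = r')
    (ha : lev ≠ 𝔸.totalArity + 1 → a = a') (hc : c ≠ 0) (hc' : c' ≠ 2)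
    (h : c = 1 → c' = 1 → lev = 0 ∨ lev = 𝔸.totalArity + 1 ∨ IsSingle a r (lev - 1)) :
    𝔸.toDigraph.Adj (mkV a r lev c) (mkV a' r' (lev + 1) c') := by
  by_cases h0 : lev = 0
  · rw [← ha (by omega), h0, mkV_zero, ← mkV_zero _ r' 2]
    exact adj_mkV _ _ _ _ _ (by omega) (by decide) hc' (by simp)
  · rw [← hr h0]
    by_cases h1 : lev = 𝔸.totalArity + 1
    · rw [h1, mkV_top, ← mkV_top a _ 0]
      exact adj_mkV _ _ _ _ _ le_rfl hc (by decide) (by simp)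
    · rw [← ha h1]
      exact adj_mkV _ _ _ _ _ hlev hc hc' h

/-- The edges of `𝒟(𝔸)` in terms of the coordinates of the vertices. -/
theorem adj_iff [Inhabited A] [Inhabited 𝔸.prodRel] {x y : DVertex 𝔸} :
    𝔸.toDigraph.Adj x y ↔
      y.lvl = x.lvl + 1 ∧ x.lvl ≤ 𝔸.totalArity + 1 ∧
      (x.lvl ≠ 0 → x.projR = y.projR) ∧ (x.lvl ≠ 𝔸.totalArity + 1 → x.projA = y.projA) ∧
      x.kind ≠ 0 ∧ y.kind ≠ 2 ∧
      (x.kind = 1 → y.kind = 1 → x.lvl = 0 ∨ x.lvl = 𝔸.totalArity + 1 ∨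
        IsSingle x.projA x.projR (x.lvl - 1)) := by
  constructor
  · rintro ⟨a, r, p, q, h, rfl, rfl⟩
    cases h with
    | single l h =>
      have : IsSingle a r l := ⟨l.2, h⟩
      have := l.2
      simp [DVertex.ofPath, DVertex.lvl, DVertex.kind, DVertex.projA, DVertex.projR, *]
    | _ =>
      simp [DVertex.ofPath, DVertex.lvl, DVertex.kind, DVertex.projA, DVertex.projR]
  · rintro ⟨h₁, h₂, h₃, h₄, h₅, h₆, h₇⟩
    rw [x.eq_mkV, y.eq_mkV, h₁]
    exact adj_mkV_of_eq h₂ h₃ h₄ h₅ h₆ h₇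

end Coordinates

/-! ### Extending operations from `𝔸` to `𝒟(𝔸)` -/

/-- The element of `s` with the least key. -/
noncomputable def pick {V K : Type*} [Nonempty V] [LE K] (key : V → K) (s : Set V) : V :=
  Classical.epsilon fun x => x ∈ s ∧ ∀ y ∈ s, key x ≤ key y

theorem pick_spec {V K : Type*} [Nonempty V] [LinearOrder K] (key : V → K) {s : Set V}
    (hs : s.Finite) (hne : s.Nonempty) : pick key s ∈ s ∧ ∀ y ∈ s, key (pick key s) ≤ key y :=
  Classical.epsilon_spec (p := fun x => x ∈ s ∧ ∀ y ∈ s, key x ≤ key y)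
    (Set.exists_min_image s key hs hne)

theorem pick_singleton {V K : Type*} [Nonempty V] [LinearOrder K] (key : V → K) (x : V) :
    pick key {x} = x :=
  (pick_spec key (Set.finite_singleton x) (Set.singleton_nonempty x)).1

/-- The two minima may sit at different indices `i` and `j`, so the edge needed is a crossing one.
-/
theorem adj_pick {V K : Type*} [Nonempty V] [LinearOrder K] (G : Digraph V) (key : V → K) {m : ℕ}
    {t t' : Fin m → V} {M : Set (Fin m)} (hM : M.Nonempty)
    (hkey : ∀ i ∈ M, ∀ j ∈ M, key (t i) ≤ key (t j) → key (t' j) ≤ key (t' i) →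
      G.Adj (t i) (t' j)) :
    G.Adj (pick key (t '' M)) (pick key (t' '' M)) := by
  obtain ⟨⟨i, hi, ei⟩, hmin⟩ := pick_spec key (M.toFinite.image t) (hM.image t)
  obtain ⟨⟨j, hj, ej⟩, hmin'⟩ := pick_spec key (M.toFinite.image t') (hM.image t')
  rw [← ei] at hmin ⊢
  rw [← ej] at hmin' ⊢
  exact hkey i hi j hj (hmin _ ⟨j, hj, rfl⟩) (hmin' _ ⟨i, hi, rfl⟩)

/-- An injective numbering of a countable type. -/
noncomputable def numbering (B : Type*) [Countable B] : B → ℕ :=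
  (exists_injective_nat B).choose

theorem numbering_injective (B : Type*) [Countable B] : Function.Injective (numbering B) :=
  (exists_injective_nat B).choose_spec

/-- An idempotent polymorphism of `𝔸` together with the two idempotent Boolean operations obtained
from a polymorphism of the zigzag by restricting it to the sources and to the sinks. -/
structure IdempotentTriple {A : Type u} (𝔸 : RelStructure A) (m : ℕ) where
  /-- the polymorphism of `𝔸` -/
  f : (Fin m → A) → A
  /-- the operation on the sources of the zigzag -/
  low : (Fin m → Prop) → Prop
  /-- the operation on the sinks of the zigzag -/
  high : (Fin m → Prop) → Prop
  isPolymorphism : 𝔸.IsPolymorphism f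
  f_const : ∀ a, f (fun _ => a) = a
  low_const : ∀ p, low (fun _ => p) = p
  high_const : ∀ p, high (fun _ => p) = p
  low_of_high : ∀ x y, (∀ i, y i → x i) → high y → low x

section Extension

variable {A : Type u} {𝔸 : RelStructure A}

theorem prodRel_closed {m : ℕ} {f : (Fin m → A) → A} (hf : 𝔸.IsPolymorphism f)
    (r : Fin m → 𝔸.prodRel) : (fun j => f fun i => (r i).1 j) ∈ 𝔸.prodRel :=
  fun i => hf i (fun j l => (r j).1 (finSigmaFinEquiv ⟨i, l⟩)) fun j => (r j).2 i

/-- The coordinatewise action of a polymorphism on the tuples of `R`. -/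
def IdempotentTriple.onTuples {m : ℕ} (T : IdempotentTriple 𝔸 m) (r : Fin m → 𝔸.prodRel) :
    𝔸.prodRel :=
  ⟨_, prodRel_closed T.isPolymorphism r⟩

theorem IdempotentTriple.isSingle {m : ℕ} (T : IdempotentTriple 𝔸 m) {a : Fin m → A}
    {r : Fin m → 𝔸.prodRel} {j : ℕ} (hj : j < 𝔸.totalArity) (h : ∀ i, IsSingle (a i) (r i) j) :
    IsSingle (T.f a) (T.onTuples r) j :=
  ⟨hj, congrArg T.f (funext fun i => (h i).snd)⟩

variable [Inhabited A] [Inhabited 𝔸.prodRel]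

instance : Nonempty (DVertex 𝔸) := ⟨.elem default⟩

open Classical in
/-- The kind of the value at a tuple with set of entries `s`, all of the same level. The parameters
`lo` and `hi` apply the Boolean operations to a property of the entries. -/
noncomputable def kindOp (s : Set (DVertex 𝔸)) (lo hi : (DVertex 𝔸 → Prop) → Prop) : Fin 3 :=
  if ∃ x ∈ s, x.kind = 2 then
    if ∃ x ∈ s, x.kind = 0 then
      if lo fun x => x.kind ≠ 0 then 2 else 0
    else if lo fun x => x.kind = 1 → IsSingle x.projA x.projR (x.lvl - 1) then 2 else 1
  else if ∃ x ∈ s, x.kind = 0 then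
    if hi fun x => x.kind = 1 ∧ ¬ IsSingle x.projA x.projR (x.lvl - 2) then 1 else 0
  else 1

/-! ### Linear orders on the vertices, for tuples of unequal levels -/

variable [Finite A]

/-- Vertices are compared by `a`, then by `r`, then by kind. -/
noncomputable def keyA (x : DVertex 𝔸) : ℕ ×ₗ ℕ ×ₗ Fin 3 :=
  toLex (numbering A x.projA, toLex (numbering 𝔸.prodRel x.projR, x.kind))

/-- Vertices are compared by `r`, then by `a`, then by kind. -/
noncomputable def keyR (x : DVertex 𝔸) : ℕ ×ₗ ℕ ×ₗ Fin 3 :=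
  toLex (numbering 𝔸.prodRel x.projR, toLex (numbering A x.projA, x.kind))

theorem keyA_le_iff {x y : DVertex 𝔸} : keyA x ≤ keyA y ↔
    numbering A x.projA < numbering A y.projA ∨ x.projA = y.projA ∧
      (numbering _ x.projR < numbering _ y.projR ∨ x.projR = y.projR ∧ x.kind ≤ y.kind) := by
  simp [keyA, Prod.Lex.toLex_le_toLex, (numbering_injective _).eq_iff]

theorem keyR_le_iff {x y : DVertex 𝔸} : keyR x ≤ keyR y ↔
    numbering _ x.projR < numbering _ y.projR ∨ x.projR = y.projR ∧
      (numbering _ x.projA < numbering _ y.projA ∨ x.projA = y.projA ∧ x.kind ≤ y.kind) := by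
  simp [keyR, Prod.Lex.toLex_le_toLex, (numbering_injective _).eq_iff]

/-- Below level `k + 1` an edge keeps the element, the leading part of the key, so the opposite
inequalities force equal elements, and above level 0 then equal tuples. If `x` and `y'` are joints,
then `y'.kind ≤ y.kind ≠ 2` makes `y` a joint too, so the segment is single. -/
theorem adj_of_keyA_le {x y x' y' : DVertex 𝔸} (h : 𝔸.toDigraph.Adj x y)
    (h' : 𝔸.toDigraph.Adj x' y') (hl : x.lvl = x'.lvl) (hlt : x.lvl ≤ 𝔸.totalArity)
    (hx : keyA x ≤ keyA x') (hy : keyA y' ≤ keyA y) : 𝔸.toDigraph.Adj x y' := by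
  rw [adj_iff] at h h' ⊢
  rw [keyA_le_iff] at hx hy
  obtain ⟨h₁, h₂, h₃, h₄, h₅, h₆, h₇⟩ := h
  obtain ⟨h₁', h₂', h₃', h₄', h₅', h₆', h₇'⟩ := h'
  rw [← h₄ (by omega), ← h₄' (by omega)] at hy
  have ea : x.projA = x'.projA := by
    rcases hx with hx | hx <;> rcases hy with hy | hy
    · omega
    · rw [hy.1] at hx
      omega
    · exact hx.1
    · exact hx.1
  simp only [ea, lt_irrefl, true_and, false_or] at hx hy
  refine ⟨by omega, h₂, fun h0 => ?_, fun _ => by rw [ea, h₄' (by omega)], h₅, h₆', ?_⟩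
  · rw [← h₃ h0, ← h₃' (by omega)] at hy
    rw [← h₃' (by omega)]
    rcases hx with hx | hx <;> rcases hy with hy | hy
    · omega
    · rw [hy.1] at hx
      omega
    · exact hx.1
    · exact hx.1
  · intro e e'
    by_cases h0 : x.lvl = 0
    · exact .inl h0
    · rw [← h₃ h0, ← h₃' (by omega)] at hy
      refine h₇ e ?_
      have : y'.kind ≤ y.kind := by
        rcases hx with hx | hx <;> rcases hy with hy | hy
        · omega
        · rw [hy.1] at hx
          omega
        · rw [hx.1] at hy
          omega
        · exact hy.2
      omega

/-- Above level 0 the tuple is what an edge always keeps, so it has to lead the key. -/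
theorem adj_of_keyR_le {x y x' y' : DVertex 𝔸} (h : 𝔸.toDigraph.Adj x y)
    (h' : 𝔸.toDigraph.Adj x' y') (hl : x.lvl = x'.lvl) (hlt : x.lvl ≠ 0)
    (hx : keyR x ≤ keyR x') (hy : keyR y' ≤ keyR y) : 𝔸.toDigraph.Adj x y' := by
  rw [adj_iff] at h h' ⊢
  rw [keyR_le_iff] at hx hy
  obtain ⟨h₁, h₂, h₃, h₄, h₅, h₆, h₇⟩ := h
  obtain ⟨h₁', h₂', h₃', h₄', h₅', h₆', h₇'⟩ := h'
  rw [← h₃ (by omega), ← h₃' (by omega)] at hy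
  have ea : x.projR = x'.projR := by
    rcases hx with hx | hx <;> rcases hy with hy | hy
    · omega
    · rw [hy.1] at hx
      omega
    · exact hx.1
    · exact hx.1
  simp only [ea, lt_irrefl, true_and, false_or] at hx hy
  refine ⟨by omega, h₂, fun _ => by rw [ea, h₃' (by omega)], fun h0 => ?_, h₅, h₆', ?_⟩
  · rw [← h₄ h0, ← h₄' (by omega)] at hy
    rw [← h₄' (by omega)]
    rcases hx with hx | hx <;> rcases hy with hy | hy
    · omega
    · rw [hy.1] at hx
      omega
    · exact hx.1
    · exact hx.1
  · intro e e'
    by_cases h0 : x.lvl = 𝔸.totalArity + 1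
    · exact .inr (.inl h0)
    · rw [← h₄ h0, ← h₄' (by omega)] at hy
      refine h₇ e ?_
      have : y'.kind ≤ y.kind := by
        rcases hx with hx | hx <;> rcases hy with hy | hy
        · omega
        · rw [hy.1] at hx
          omega
        · rw [hx.1] at hy
          omega
        · exact hy.2
      omega

open Classical in
/-- The value at a tuple with set of entries `s`, where `a` and `r` are the values of the given
polymorphism at the projections of the tuple, and `lo` and `hi` apply the Boolean operations to a
property of the entries. -/
noncomputable def combine (s : Set (DVertex 𝔸)) (a : A) (r : 𝔸.prodRel)
    (lo hi : (DVertex 𝔸 → Prop) → Prop) : DVertex 𝔸 :=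
  if ∀ x ∈ s, ∀ y ∈ s, x.lvl = y.lvl then
    mkV a r (sInf (DVertex.lvl '' s)) (kindOp s lo hi)
  else if lo fun x => ∃ y ∈ s, y.lvl < x.lvl then
    pick keyR {x ∈ s | ∀ y ∈ s, y.lvl ≤ x.lvl}
  else pick keyA {x ∈ s | ∀ y ∈ s, x.lvl ≤ y.lvl}

/-- The operation on `𝒟(𝔸)` obtained from an operation on `𝔸`. -/
noncomputable def IdempotentTriple.extend {m : ℕ} (T : IdempotentTriple 𝔸 m)
    (t : Fin m → DVertex 𝔸) : DVertex 𝔸 :=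
  combine (Set.range t) (T.f fun i => (t i).projA) (T.onTuples fun i => (t i).projR)
    (fun p => T.low fun i => p (t i)) (fun p => T.high fun i => p (t i))

/-! ### Identities inherited by the extended operations -/

theorem combine_of_subset_pair {s : Set (DVertex 𝔸)} {x y : DVertex 𝔸} (hx : x ∈ s)
    (hs : ∀ z ∈ s, z = x ∨ z = y) :
    combine s x.projA x.projR (fun p => p x) (fun p => p x) = x := by
  unfold combine
  split_ifs with h₁ h₂
  · have e : DVertex.lvl '' s = {x.lvl} := by
      ext n
      constructor
      · rintro ⟨z, hz, rfl⟩
        exact h₁ z hz x hx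
      · rintro rfl
        exact ⟨x, hx, rfl⟩
    rw [e, csInf_singleton]
    conv_rhs => rw [x.eq_mkV]
    have hk : x.kind = 0 ∨ x.kind = 1 ∨ x.kind = 2 := by omega
    unfold kindOp
    rcases hk with hk | hk | hk
    · have h0 : ∃ z ∈ s, z.kind = 0 := ⟨x, hx, hk⟩
      simp [hk, h0]
    -- Any kind other than that of the joint `x` comes from `y`, so peaks and valleys cannot both
    -- occur.
    · have aux : ∀ c : Fin 3, c ≠ 1 → (∃ z ∈ s, z.kind = c) → y.kind = c := by
        rintro c hc ⟨z, hz, ec⟩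
        rcases hs z hz with rfl | rfl
        · exact absurd (ec.symm.trans hk) hc
        · exact ec
      by_cases h2 : ∃ z ∈ s, z.kind = 2
      · have h0 : ¬ ∃ z ∈ s, z.kind = 0 := fun h0 => by
          have := aux 2 (by decide) h2
          simp [aux 0 (by decide) h0] at this
        rw [if_pos h2, if_neg h0]
        -- `kindOp` may answer "valley" here, but only if the segment after `x` is single, and then
        -- `mkV` falls back to the joint `x`.
        split_ifs with hsing
        · rw [hk]
          obtain ⟨z, hz, e2⟩ := h2
          have := lvl_le_of_kind_eq_two e2
          rw [h₁ z hz x hx] at this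
          obtain ⟨j, hj⟩ : ∃ j, x.lvl = j + 1 := ⟨x.lvl - 1, by omega⟩
          rw [hj]
          refine mkV_valley_of_isSingle _ _ _ fun _ => ?_
          simpa [hj] using hsing hk
        · rw [hk]
      · rw [if_neg h2]
        split_ifs with h0 hsing
        · rw [hk]
        · rw [hk]
          obtain ⟨z, hz, e0⟩ := h0
          have := two_le_lvl_of_kind_eq_zero e0
          rw [h₁ z hz x hx] at this
          obtain ⟨j, hj⟩ : ∃ j, x.lvl = j + 2 := ⟨x.lvl - 2, by omega⟩
          rw [hj]
          refine mkV_peak_of_isSingle _ _ _ ?_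
          simpa [hj, hk] using hsing
        · rw [hk]
    · have h2 : ∃ z ∈ s, z.kind = 2 := ⟨x, hx, hk⟩
      simp [hk, h2]
  -- The bit says that `x` lies above some entry, which must be `y`; so `x` is the only highest
  -- entry.
  · have e : {x ∈ s | ∀ y ∈ s, y.lvl ≤ x.lvl} = {x} := by
      obtain ⟨z, hz, hlt⟩ := h₂
      have hzy : z = y := (hs z hz).resolve_left fun e => by simp [e] at hlt
      subst hzy
      ext z'
      constructor
      · rintro ⟨hz', hm⟩
        refine (hs z' hz').resolve_right fun e => ?_
        have := hm x hx
        rw [e] at this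
        omega
      · rintro rfl
        refine ⟨hx, fun w hw => ?_⟩
        rcases hs w hw with rfl | rfl
        · exact le_rfl
        · exact hlt.le
    rw [e, pick_singleton]
  · have e : {x ∈ s | ∀ y ∈ s, x.lvl ≤ y.lvl} = {x} := by
      have hxy : x.lvl < y.lvl ∧ y ∈ s := by
        by_contra hne
        refine h₁ fun z hz z' hz' => ?_
        have key : ∀ z ∈ s, z.lvl = x.lvl := fun z hz => by
          rcases hs z hz with rfl | rfl
          · rfl
          · have : ¬ z.lvl < x.lvl := fun h => h₂ ⟨z, hz, h⟩
            have : ¬ x.lvl < z.lvl := fun h => hne ⟨h, hz⟩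
            omega
        rw [key z hz, key z' hz']
      ext z'
      constructor
      · rintro ⟨hz', hm⟩
        refine (hs z' hz').resolve_right fun e => ?_
        have := hm x hx
        rw [e] at this
        omega
      · rintro rfl
        refine ⟨hx, fun w hw => ?_⟩
        rcases hs w hw with rfl | rfl
        · exact le_rfl
        · exact hxy.1.le
    rw [e, pick_singleton]

/-- A tuple with entries `x` and `y` at which all the operations act like a projection to `x`. -/
theorem IdempotentTriple.extend_eq_of_subset_pair {m : ℕ} (T : IdempotentTriple 𝔸 m)
    {t : Fin m → DVertex 𝔸} {x y : DVertex 𝔸} (ht : ∀ i, t i = x ∨ t i = y)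
    (hf : ∀ φ : DVertex 𝔸 → A, T.f (fun i => φ (t i)) = φ x)
    (hlow : ∀ φ : DVertex 𝔸 → Prop, T.low (fun i => φ (t i)) = φ x)
    (hhigh : ∀ φ : DVertex 𝔸 → Prop, T.high (fun i => φ (t i)) = φ x) :
    T.extend t = x := by
  -- If `x` were absent, the property `z = x` would be constantly false on the entries but true at
  -- `x`.
  have hx : x ∈ Set.range t := by
    by_contra hx
    have h := hlow (fun z => z = x)
    have e : (fun i => t i = x) = fun _ => False := by
      funext i
      exact eq_false fun h => hx ⟨i, h⟩
    simp [e, T.low_const] at h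
  have hr : T.onTuples (fun i => (t i).projR) = x.projR :=
    Subtype.ext (funext fun j => hf fun z => z.projR.1 j)
  unfold extend
  rw [hf, hr]
  simp only [hlow, hhigh]
  exact combine_of_subset_pair hx (Set.forall_mem_range.2 ht)

theorem IdempotentTriple.extend_const {m : ℕ} (T : IdempotentTriple 𝔸 m) (x : DVertex 𝔸) :
    T.extend (fun _ => x) = x :=
  T.extend_eq_of_subset_pair (y := x) (fun _ => .inl rfl) (fun _ => T.f_const _)
    (fun _ => T.low_const _) (fun _ => T.high_const _)

/-- Balanced identities between operations are inherited by their extensions. -/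
theorem IdempotentTriple.extend_eq_of_range_eq {m m' : ℕ} (T : IdempotentTriple 𝔸 m)
    (T' : IdempotentTriple 𝔸 m') {t : Fin m → DVertex 𝔸} {t' : Fin m' → DVertex 𝔸}
    (ht : Set.range t = Set.range t')
    (hf : ∀ φ : DVertex 𝔸 → A, T.f (fun i => φ (t i)) = T'.f (fun i => φ (t' i)))
    (hlow : ∀ φ : DVertex 𝔸 → Prop, T.low (fun i => φ (t i)) = T'.low (fun i => φ (t' i)))
    (hhigh : ∀ φ : DVertex 𝔸 → Prop, T.high (fun i => φ (t i)) = T'.high (fun i => φ (t' i))) :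
    T.extend t = T'.extend t' := by
  have hr : T.onTuples (fun i => (t i).projR) = T'.onTuples (fun i => (t' i).projR) :=
    Subtype.ext (funext fun j => hf fun z => z.projR.1 j)
  unfold extend
  rw [hf, hr, ht]
  simp only [hlow, hhigh]

/-! ### Extended operations preserve edges -/

theorem IdempotentTriple.extend_of_lvl_eq {m : ℕ} (hm : m ≠ 0) (T : IdempotentTriple 𝔸 m)
    {t : Fin m → DVertex 𝔸} {lev : ℕ} (ht : ∀ i, (t i).lvl = lev) :
    T.extend t = mkV (T.f fun i => (t i).projA) (T.onTuples fun i => (t i).projR) lev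
      (kindOp (Set.range t) (fun p => T.low fun i => p (t i)) fun p => T.high fun i => p (t i)) := by
  have : Nonempty (Fin m) := ⟨⟨0, Nat.pos_of_ne_zero hm⟩⟩
  have e : DVertex.lvl '' Set.range t = {lev} := by
    rw [← Set.range_comp, ← Set.range_const (ι := Fin m)]
    exact congrArg _ (funext ht)
  unfold extend combine
  rw [if_pos, e, csInf_singleton]
  rintro _ ⟨i, rfl⟩ _ ⟨j, rfl⟩
  rw [ht, ht]

theorem IdempotentTriple.adj_extend_of_lvl_eq {m : ℕ} (hm : m ≠ 0) (T : IdempotentTriple 𝔸 m)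
    {t t' : Fin m → DVertex 𝔸} (h : ∀ i, 𝔸.toDigraph.Adj (t i) (t' i)) {lev : ℕ}
    (ht : ∀ i, (t i).lvl = lev) : 𝔸.toDigraph.Adj (T.extend t) (T.extend t') := by
  simp only [adj_iff] at h
  have ht' : ∀ i, (t' i).lvl = lev + 1 := fun i => by rw [(h i).1, ht]
  rw [T.extend_of_lvl_eq hm ht, T.extend_of_lvl_eq hm ht']
  have h0 : ¬ ∃ x ∈ Set.range t, x.kind = 0 := by
    rintro ⟨_, ⟨i, rfl⟩, e⟩
    exact (h i).2.2.2.2.1 e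
  have h2 : ¬ ∃ x ∈ Set.range t', x.kind = 2 := by
    rintro ⟨_, ⟨i, rfl⟩, e⟩
    exact (h i).2.2.2.2.2.1 e
  have hlev : lev ≤ 𝔸.totalArity + 1 := by
    have := (h ⟨0, Nat.pos_of_ne_zero hm⟩).2.1
    rwa [ht] at this
  unfold kindOp
  rw [if_neg h0, if_neg h2]
  refine adj_mkV_of_eq hlev ?_ ?_ ?_ ?_ ?_
  · exact fun hl => congrArg T.onTuples (funext fun i => (h i).2.2.1 (by rwa [ht]))
  · exact fun hl => congrArg T.f (funext fun i => (h i).2.2.2.1 (by rwa [ht]))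
  · split_ifs <;> decide
  · split_ifs <;> decide
  · intro e e'
    -- The only possible failure: both values are joints, on the two sides of a segment that is not
    -- single.
    by_contra! hcon
    obtain ⟨hl0, hl1, hns⟩ := hcon
    have hS : ∀ i, (t i).kind = 1 → (t' i).kind = 1 →
        IsSingle (t i).projA (t i).projR (lev - 1) := fun i e₁ e₂ => by
      have := (h i).2.2.2.2.2.2 e₁ e₂
      rw [ht] at this
      exact (this.resolve_left hl0).resolve_left hl1
    have hS' : ∀ i, IsSingle (t' i).projA (t' i).projR ((t' i).lvl - 2) ↔
        IsSingle (t i).projA (t i).projR (lev - 1) := fun i => by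
      rw [← (h i).2.2.1 (by rwa [ht]), ← (h i).2.2.2.1 (by rwa [ht]), ht',
        show lev + 1 - 2 = lev - 1 by omega]
    simp only [Set.exists_range_iff, hS', ht] at e e'
    by_cases hV : ∃ i, (t i).kind = 2
    · have hlow : ¬ T.low fun i => (t i).kind = 1 → IsSingle (t i).projA (t i).projR (lev - 1) := by
        intro hlow
        simp only [if_pos hV, ite_eq_right_iff] at e
        simp only [ht] at e
        exact absurd (e hlow) (by decide)
      by_cases hP : ∃ i, (t' i).kind = 0
      · have hhigh : T.high fun i =>
            (t' i).kind = 1 ∧ ¬ IsSingle (t i).projA (t i).projR (lev - 1) := by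
          by_contra hhigh
          simp only [if_pos hP, ite_eq_left_iff] at e'
          simp only [hS'] at e'
          exact absurd (e' hhigh) (by decide)
        -- A joint over a joint at index `i` means that segment is single, which gives the
        -- implication between the arguments of `high` and `low`.
        refine hlow (T.low_of_high _ _ (fun i hi hk => ?_) hhigh)
        exact hS i hk hi.1
      · refine hlow ?_
        have : (fun i => (t i).kind = 1 → IsSingle (t i).projA (t i).projR (lev - 1)) =
            fun _ => True := funext fun i => eq_true fun hk => hS i hk (by
          have := (h i).2.2.2.2.2.1
          have : (t' i).kind ≠ 0 := fun h => hP ⟨i, h⟩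
          omega)
        rw [this, T.low_const]
        trivial
    -- Without valleys below, each joint above ends a single segment, so `high` sees a constantly
    -- false argument; without peaks as well, all segments are single, and so is that of the value.
    · have hk : ∀ i, (t i).kind = 1 := fun i => by
        have := (h i).2.2.2.2.1
        have : (t i).kind ≠ 2 := fun h => hV ⟨i, h⟩
        omega
      have hP : ∃ i, (t' i).kind = 0 := by
        by_contra hP
        refine hns (T.isSingle (by omega) fun i => hS i (hk i) ?_)
        have := (h i).2.2.2.2.2.1
        have : (t' i).kind ≠ 0 := fun h => hP ⟨i, h⟩
        omega
      have hhigh : T.high fun i =>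
          (t' i).kind = 1 ∧ ¬ IsSingle (t i).projA (t i).projR (lev - 1) := by
        by_contra hhigh
        simp only [if_pos hP, ite_eq_left_iff] at e'
        simp only [hS'] at e'
        exact absurd (e' hhigh) (by decide)
      have : (fun i => (t' i).kind = 1 ∧ ¬ IsSingle (t i).projA (t i).projR (lev - 1)) =
          fun _ => False := funext fun i => eq_false fun hi => hi.2 (hS i (hk i) hi.1)
      rw [this, T.high_const] at hhigh
      exact hhigh

/-- An edge shifts all levels by one, so for unequal levels both sides have the same extremal
indices and the same argument of `low`. -/
theorem IdempotentTriple.adj_extend {m : ℕ} (hm : m ≠ 0) (T : IdempotentTriple 𝔸 m)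
    {t t' : Fin m → DVertex 𝔸} (h : ∀ i, 𝔸.toDigraph.Adj (t i) (t' i)) :
    𝔸.toDigraph.Adj (T.extend t) (T.extend t') := by
  have : Nonempty (Fin m) := ⟨⟨0, Nat.pos_of_ne_zero hm⟩⟩
  have hl : ∀ i, (t' i).lvl = (t i).lvl + 1 := fun i => (adj_iff.1 (h i)).1
  by_cases hs : ∀ i j, (t i).lvl = (t j).lvl
  · exact T.adj_extend_of_lvl_eq hm h fun i => hs i ⟨0, Nat.pos_of_ne_zero hm⟩
  unfold extend combine
  have himage : ∀ (t : Fin m → DVertex 𝔸) (q : DVertex 𝔸 → Prop),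
      {x ∈ Set.range t | q x} = t '' {i | q (t i)} := fun t q => by
    ext x
    constructor
    · rintro ⟨⟨i, rfl⟩, hq⟩
      exact ⟨i, hq, rfl⟩
    · rintro ⟨i, hq, rfl⟩
      exact ⟨⟨i, rfl⟩, hq⟩
  have hbit : (fun i => ∃ y ∈ Set.range t', y.lvl < (t' i).lvl) =
      fun i => ∃ y ∈ Set.range t, y.lvl < (t i).lvl := by
    simp [hl]
  simp only [himage, Set.forall_mem_range, Set.exists_range_iff, hl, Nat.add_right_cancel_iff,
    Nat.add_le_add_iff_right, Nat.add_lt_add_iff_right, if_neg hs]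
  split_ifs with hb hb' hb'
  · obtain ⟨i₀, -, hi₀⟩ := Set.exists_max_image Set.univ (fun i => (t i).lvl) Set.finite_univ
      Set.univ_nonempty
    -- A highest level of 0 would make all levels equal; in the other case, so would a lowest level
    -- of `k + 1`.
    refine adj_pick _ _ ⟨i₀, fun j => hi₀ j trivial⟩ fun i (hi : ∀ _, _) j (hj : ∀ _, _) h₁ h₂ =>
      adj_of_keyR_le (h i) (h j) (le_antisymm (hj i) (hi j)) (fun h0 => hs fun j j' => ?_) h₁ h₂
    have := hi j
    have := hi j'
    omega
  · exact absurd (hbit ▸ hb) hb'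
  · exact absurd (hbit ▸ hb') hb
  · obtain ⟨i₀, -, hi₀⟩ := Set.exists_min_image Set.univ (fun i => (t i).lvl) Set.finite_univ
      Set.univ_nonempty
    refine adj_pick _ _ ⟨i₀, fun j => hi₀ j trivial⟩ fun i (hi : ∀ _, _) j (hj : ∀ _, _) h₁ h₂ =>
      adj_of_keyA_le (h i) (h j) (le_antisymm (hi j) (hj i))
        (not_lt.1 fun h0 => hs fun j j' => ?_) h₁ h₂
    have := hi j
    have := hi j'
    have := (adj_iff.1 (h j)).2.1
    have := (adj_iff.1 (h j')).2.1
    omega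

end Extension

/-! ### Restricting operations from `𝒟(𝔸)` to `𝔸` -/

theorem isPolymorphism_digraph_iff {V : Type u} {G : Digraph V} {m : ℕ} {f : (Fin m → V) → V} :
    (digraphStructure G).IsPolymorphism f ↔
      ∀ t t' : Fin m → V, (∀ i, G.Adj (t i) (t' i)) → G.Adj (f t) (f t') := by
  constructor
  · exact fun h t t' ht => h (0 : Fin 1) (fun i => ![t i, t' i]) ht
  · exact fun h _ t ht => h (fun i => t i (0 : Fin 2)) (fun i => t i (1 : Fin 2)) ht

section Restriction

variable {A : Type u} {𝔸 : RelStructure A}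

theorem blocks_apply (β : ∀ i, Fin (𝔸.arity i) → A) (i : Fin 𝔸.numRel) (j : Fin (𝔸.arity i)) :
    (fun p : Σ i, Fin (𝔸.arity i) => β p.1 p.2) (finSigmaFinEquiv.symm (finSigmaFinEquiv ⟨i, j⟩)) =
      β i j := by
  rw [Equiv.symm_apply_apply]

/-- The tuple of `R` with the given blocks. -/
def tupleOfBlocks (β : ∀ i, Fin (𝔸.arity i) → A) (hβ : ∀ i, β i ∈ 𝔸.rel i) : 𝔸.prodRel :=
  ⟨fun p => β (finSigmaFinEquiv.symm p).1 (finSigmaFinEquiv.symm p).2, fun i => by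
    rw [show (fun j => β (finSigmaFinEquiv.symm (finSigmaFinEquiv ⟨i, j⟩)).1
      (finSigmaFinEquiv.symm (finSigmaFinEquiv ⟨i, j⟩)).2) = β i from funext (blocks_apply β i)]
    exact hβ i⟩

theorem tupleOfBlocks_apply (β : ∀ i, Fin (𝔸.arity i) → A) (hβ : ∀ i, β i ∈ 𝔸.rel i)
    (i : Fin 𝔸.numRel) (j : Fin (𝔸.arity i)) :
    (tupleOfBlocks β hβ).1 (finSigmaFinEquiv ⟨i, j⟩) = β i j :=
  blocks_apply β i j

theorem nonempty_prodRel (hne : ∀ i, (𝔸.rel i).Nonempty) : Nonempty 𝔸.prodRel :=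
  ⟨tupleOfBlocks (fun i => (hne i).some) fun i => (hne i).some_mem⟩

variable [Inhabited A] [Inhabited 𝔸.prodRel]

theorem polymorphism_elem_tuple {m : ℕ} {f : (Fin m → DVertex 𝔸) → DVertex 𝔸}
    (hf : (digraphStructure 𝔸.toDigraph).IsPolymorphism f) (a : Fin m → A)
    (r : Fin m → 𝔸.prodRel) :
    (f fun i => .elem (a i)).lvl = 0 ∧ (f fun i => .tuple (r i)).lvl = 𝔸.totalArity + 2 ∧
      ∀ l, (∀ i, a i = (r i).1 l) →
        (f fun i => .elem (a i)).projA = (f fun i => .tuple (r i)).projR.1 l := by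
  rw [isPolymorphism_digraph_iff] at hf
  -- The image of the all-zigzag path, run through simultaneously in all coordinates.
  let W : ℕ → Fin 3 → DVertex 𝔸 := fun lev c => f fun i => mkV (a i) (r i) lev c
  have hbot : (f fun i => .elem (a i)) = W 0 1 := by
    simp only [W, mkV_zero]
  have htop : (f fun i => .tuple (r i)) = W (𝔸.totalArity + 2) 1 := by
    simp only [W, mkV_top]
  have e₁ : ∀ lev ≤ 𝔸.totalArity + 1, 𝔸.toDigraph.Adj (W lev 1) (W (lev + 1) 0) :=
    fun lev h => hf _ _ fun i => adj_mkV _ _ _ _ _ h (by decide) (by decide) (by simp)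
  have e₂ : ∀ lev ≤ 𝔸.totalArity + 1, 𝔸.toDigraph.Adj (W lev 2) (W (lev + 1) 0) :=
    fun lev h => hf _ _ fun i => adj_mkV _ _ _ _ _ h (by decide) (by decide) (by simp)
  have e₃ : ∀ lev ≤ 𝔸.totalArity + 1, 𝔸.toDigraph.Adj (W lev 2) (W (lev + 1) 1) :=
    fun lev h => hf _ _ fun i => adj_mkV _ _ _ _ _ h (by decide) (by decide) (by simp)
  rw [hbot, htop]
  have hstep : ∀ lev ≤ 𝔸.totalArity + 2, (W lev 1).lvl = (W 0 1).lvl + lev := by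
    intro lev
    induction lev with
    | zero => simp
    | succ lev ih =>
      intro h
      have := ih (by omega)
      have := (adj_iff.1 (e₁ lev (by omega))).1
      have := (adj_iff.1 (e₂ lev (by omega))).1
      have := (adj_iff.1 (e₃ lev (by omega))).1
      omega
  -- A climb of `k + 2` fits into the available levels only if it starts at 0.
  have h0 : (W 0 1).lvl = 0 := by
    have := hstep _ le_rfl
    have := (W (𝔸.totalArity + 2) 1).lvl_le
    omega
  have hlvl : ∀ lev ≤ 𝔸.totalArity + 2, (W lev 1).lvl = lev := fun lev h => by
    rw [hstep lev h, h0, zero_add]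
  have hlvl' : ∀ lev ≤ 𝔸.totalArity + 1, (W lev 2).lvl = lev := fun lev h => by
    have := (adj_iff.1 (e₃ lev h)).1
    have := hlvl (lev + 1) (by omega)
    omega
  have hA : ∀ lev ≤ 𝔸.totalArity + 1, (W lev 1).projA = (W 0 1).projA := by
    intro lev
    induction lev with
    | zero => simp
    | succ lev ih =>
      intro h
      have h₁ := (adj_iff.1 (e₁ lev (by omega))).2.2.2.1 (by rw [hlvl _ (by omega)]; omega)
      have h₂ := (adj_iff.1 (e₂ lev (by omega))).2.2.2.1 (by rw [hlvl' _ (by omega)]; omega)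
      have h₃ := (adj_iff.1 (e₃ lev (by omega))).2.2.2.1 (by rw [hlvl' _ (by omega)]; omega)
      rw [← ih (by omega), h₁, ← h₂, h₃]
  have hR : ∀ lev ≤ 𝔸.totalArity + 1, (W (lev + 1) 1).projR = (W 1 1).projR := by
    intro lev
    induction lev with
    | zero => simp
    | succ lev ih =>
      intro h
      have h₁ := (adj_iff.1 (e₁ (lev + 1) (by omega))).2.2.1 (by rw [hlvl _ (by omega)]; omega)
      have h₂ := (adj_iff.1 (e₂ (lev + 1) (by omega))).2.2.1 (by rw [hlvl' _ (by omega)]; omega)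
      have h₃ := (adj_iff.1 (e₃ (lev + 1) (by omega))).2.2.1 (by rw [hlvl' _ (by omega)]; omega)
      rw [← ih (by omega), h₁, ← h₂, h₃]
  refine ⟨h0, hlvl _ le_rfl, fun l hl => ?_⟩
  have hlt := l.2
  have hadj : 𝔸.toDigraph.Adj (W (l + 1) 1) (W (l + 1 + 1) 1) :=
    hf _ _ fun i => adj_mkV _ _ _ _ _ (by omega) (by decide) (by decide)
      fun _ _ => .inr (.inr ⟨l.2, hl i⟩)
  -- Each of the two vertices has both an incoming and an outgoing edge, so it is neither a valley
  -- nor a peak.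
  have k₁ := (adj_iff.1 (e₃ l (by omega))).2.2.2.2.2.1
  have k₂ := (adj_iff.1 (e₁ (l + 1 + 1) (by omega))).2.2.2.2.1
  obtain ⟨-, -, -, -, k₃, k₄, k₅⟩ := adj_iff.1 hadj
  have hs := k₅ (by omega) (by omega)
  rw [hlvl _ (by omega), hA _ (by omega), hR _ (by omega), ← hR (𝔸.totalArity + 1) le_rfl] at hs
  have hs := (hs.resolve_left (by omega)).resolve_left (by omega)
  exact hs.snd

/-- The restriction to `A` of an operation on `𝒟(𝔸)`. -/
def restrict {m : ℕ} (f : (Fin m → DVertex 𝔸) → DVertex 𝔸) (a : Fin m → A) : A :=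
  (f fun i => .elem (a i)).projA

theorem elem_restrict {m : ℕ} {f : (Fin m → DVertex 𝔸) → DVertex 𝔸}
    (hf : (digraphStructure 𝔸.toDigraph).IsPolymorphism f) (a : Fin m → A) :
    .elem (restrict f a) = f fun i => .elem (a i) := by
  obtain ⟨b, hb⟩ := DVertex.eq_elem_of_lvl (polymorphism_elem_tuple hf a fun _ => default).1
  rw [restrict, hb]
  rfl

theorem isPolymorphism_restrict {m : ℕ} {f : (Fin m → DVertex 𝔸) → DVertex 𝔸}
    (hf : (digraphStructure 𝔸.toDigraph).IsPolymorphism f) : 𝔸.IsPolymorphism (restrict f) := by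
  intro i α hα
  let r₀ : 𝔸.prodRel := default
  -- The tuples of the `i`-th relation are padded to tuples of `R` with the blocks of `r₀`.
  let β : Fin m → ∀ i, Fin (𝔸.arity i) → A := fun n =>
    Function.update (fun i j => r₀.1 (finSigmaFinEquiv ⟨i, j⟩)) i (α n)
  have hβ : ∀ n i', β n i' ∈ 𝔸.rel i' := fun n i' => by
    by_cases h : i' = i
    · subst h
      simpa [β] using hα n
    · simpa [β, h] using r₀.2 i'
  let r : Fin m → 𝔸.prodRel := fun n => tupleOfBlocks (β n) (hβ n)
  have hs : ∀ l, restrict f (fun n => (r n).1 l) = (f fun n => .tuple (r n)).projR.1 l :=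
    fun l => (polymorphism_elem_tuple hf (fun n => (r n).1 l) r).2.2 l fun _ => rfl
  have := (f fun n => .tuple (r n)).projR.2 i
  simp only [← hs, r, tupleOfBlocks_apply] at this
  simpa [β] using this

end Restriction

/-! ### Interpretations of terms -/

section Terms

open FirstOrder Language

variable {L : FirstOrder.Language.{v, w}}

/-- The value of a term in a structure. -/
abbrev value {M : Type*} (F : L.Structure M) (x : ℕ → M) (t : L.Term ℕ) : M :=
  @Term.realize L M F ℕ x t

/-- Compatibility is asked only for symbols occurring in `t`, so that symbols outside the identities
can be reinterpreted. -/
theorem map_value {M N : Type*} (F : L.Structure M) (G : L.Structure N) (φ : M → N)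
    (x : ℕ → M) (t : L.Term ℕ)
    (h : ∀ f ∈ opSymbols t, ∀ y, φ (F.funMap f.2 y) = G.funMap f.2 fun i => φ (y i)) :
    φ (value F x t) = value G (fun n => φ (x n)) t := by
  induction t with
  | var n => rfl
  | func f ts ih =>
    refine (h ⟨_, f⟩ (.inl rfl) _).trans (congrArg _ (funext fun i => ?_))
    exact ih i fun g hg => h g (.inr (Set.mem_iUnion.2 ⟨i, hg⟩))

/-- An injective homomorphism reflects identities. -/
theorem value_eq_of_injective {M N : Type*} {F : L.Structure M} {G : L.Structure N} {φ : M → N}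
    (hφ : Function.Injective φ)
    (h : ∀ (m : ℕ) (f : L.Functions m) y, φ (F.funMap f y) = G.funMap f fun i => φ (y i))
    {e : Identity L} (he : ∀ x, value G x e.1 = value G x e.2) (x : ℕ → M) :
    value F x e.1 = value F x e.2 :=
  hφ <| by
    rw [map_value F G φ x _ fun f _ => h _ f.2, map_value F G φ x _ fun f _ => h _ f.2, he]

theorem opCount_eq_zero {t : L.Term ℕ} (h : opCount t = 0) : ∃ n, t = .var n := by
  cases t with
  | var n => exact ⟨n, rfl⟩
  | func f ts => simp [opCount] at h

theorem linear_term_cases {t : L.Term ℕ} (h : opCount t ≤ 1) :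
    (∃ n, t = .var n) ∨
      ∃ (m : ℕ) (f : L.Functions m) (σ : Fin m → ℕ), t = .func f fun i => .var (σ i) := by
  cases t with
  | var n => exact .inl ⟨n, rfl⟩
  | func f ts =>
    have hz : ∀ i, opCount (ts i) = 0 := fun i => by
      have := Finset.single_le_sum (f := fun i => opCount (ts i)) (fun _ _ => Nat.zero_le _)
        (Finset.mem_univ i)
      simp only [opCount] at h this
      omega
    choose σ hσ using fun i => opCount_eq_zero (hz i)
    exact .inr ⟨_, f, σ, congrArg _ (funext hσ)⟩

/-- A nullary polymorphism would be a loop, and the zigzag has none. -/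
theorem arity_ne_zero {S : Set (Identity L)} (h : (digraphStructure zigzag).Satisfies S) {m : ℕ}
    (f : L.Functions m) : m ≠ 0 := by
  rintro rfl
  obtain ⟨F, hF, -⟩ := h
  have := isPolymorphism_digraph_iff.1 (hF 0 f) (fun _ => 0) (fun _ => 0) fun i => i.elim0
  simp only [zigzag] at this
  omega

theorem isPolymorphism_proj {B : Type*} (𝔹 : RelStructure B) {m : ℕ} (i : Fin m) :
    𝔹.IsPolymorphism fun x => x i :=
  fun _ _ ha => ha i

variable [L.IsAlgebraic]

theorem satisfies_of_subsingleton {B : Type*} [Subsingleton B] (𝔹 : RelStructure B)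
    (hL : ∀ (m : ℕ), L.Functions m → m ≠ 0) (S : Set (Identity L)) : 𝔹.Satisfies S :=
  ⟨{ funMap := fun {m} f x => x ⟨0, Nat.pos_of_ne_zero (hL m f)⟩ },
    fun _ _ => isPolymorphism_proj 𝔹 _, fun _ _ _ => Subsingleton.elim _ _⟩

open Classical in
/-- The symbols of an idempotent set of identities have interpretations that are all idempotent. -/
theorem RelStructure.Satisfies.exists_idempotent {B : Type*} {𝔹 : RelStructure B}
    {S : Set (Identity L)} (h : 𝔹.Satisfies S) (hL : ∀ (m : ℕ), L.Functions m → m ≠ 0)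
    (hidem : IsIdempotentSet S) :
    ∃ F : L.Structure B, (∀ (m : ℕ) (f : L.Functions m), 𝔹.IsPolymorphism (F.funMap f)) ∧
      (∀ (m : ℕ) (f : L.Functions m) (b : B), F.funMap f (fun _ => b) = b) ∧
      ∀ e ∈ S, ∀ x : ℕ → B, value F x e.1 = value F x e.2 := by
  obtain ⟨F, hF, hS⟩ := h
  -- Nothing forces the other symbols to be idempotent; they are reinterpreted as first projections.
  let used : Set (Σ m, L.Functions m) := {f | ∃ e ∈ S, f ∈ opSymbols e.1 ∪ opSymbols e.2}
  let F' : L.Structure B :=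
    { funMap := fun {m} f x =>
        if ⟨m, f⟩ ∈ used then F.funMap f x else x ⟨0, Nat.pos_of_ne_zero (hL m f)⟩ }
  have hF' : ∀ f ∈ used, ∀ x, F'.funMap f.2 x = F.funMap f.2 x := fun f hf x => if_pos hf
  have hval : ∀ t : L.Term ℕ, (∀ f ∈ opSymbols t, f ∈ used) → ∀ x, value F' x t = value F x t :=
    fun t ht x => map_value F' F id x t fun f hf y => hF' f (ht f hf) y
  refine ⟨F', fun m f => ?_, fun m f b => ?_, fun e he x => ?_⟩
  · by_cases hf : ⟨m, f⟩ ∈ used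
    · rw [show F'.funMap f = F.funMap f from funext (hF' _ hf)]
      exact hF m f
    · rw [show F'.funMap f = fun x => x ⟨0, Nat.pos_of_ne_zero (hL m f)⟩ from
        funext fun x => if_neg hf]
      exact isPolymorphism_proj 𝔹 _
  · by_cases hf : ⟨m, f⟩ ∈ used
    · rw [hF' _ hf]
      obtain ⟨e, he, hfe⟩ := hf
      obtain ⟨n, hn⟩ := hidem e he _ hfe
      exact hS _ hn fun _ => b
    · exact if_neg hf
  · rw [hval _ fun f hf => ⟨e, he, .inl hf⟩, hval _ fun f hf => ⟨e, he, .inr hf⟩]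
    exact hS e he x

end Terms

/-! ### Boolean operations from the zigzag -/

section Zigzag

open Classical in
/-- The embedding of truth values as two given elements. -/
noncomputable def embedProp {B : Type*} (b c : B) (p : Prop) : B := if p then c else b

theorem embedProp_injective {B : Type*} {b c : B} (h : b ≠ c) :
    Function.Injective (embedProp b c) := by
  intro p q hpq
  by_cases hp : p <;> by_cases hq : q <;> simp_all [embedProp]

theorem embedProp_eq_iff {B : Type*} {b c : B} (h : b ≠ c) {p : Prop} :
    embedProp b c p = c ↔ p := by
  by_cases hp : p <;> simp [embedProp, hp, h]

variable {m : ℕ} {f : (Fin m → Fin 4) → Fin 4}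

/-- Idempotence fixes the vertex 1, so its set of in-neighbours `{0, 2}` is preserved. -/
theorem zigzag_low (hf : (digraphStructure zigzag).IsPolymorphism f)
    (hidem : ∀ b, f (fun _ => b) = b) (p : Fin m → Prop) :
    embedProp 0 2 (f (fun i => embedProp 0 2 (p i)) = 2) = f fun i => embedProp 0 2 (p i) := by
  have h := isPolymorphism_digraph_iff.1 hf (fun i => embedProp 0 2 (p i)) (fun _ => 1) fun i => by
    by_cases hp : p i <;> simp [embedProp, hp, zigzag]
  rw [hidem] at h
  generalize f _ = b at h
  simp only [zigzag] at h
  have : b = 0 ∨ b = 2 := by omega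
  rcases this with rfl | rfl <;> simp [embedProp]

theorem zigzag_high (hf : (digraphStructure zigzag).IsPolymorphism f)
    (hidem : ∀ b, f (fun _ => b) = b) (p : Fin m → Prop) :
    embedProp 1 3 (f (fun i => embedProp 1 3 (p i)) = 3) = f fun i => embedProp 1 3 (p i) := by
  have h := isPolymorphism_digraph_iff.1 hf (fun _ => 2) (fun i => embedProp 1 3 (p i)) fun i => by
    by_cases hp : p i <;> simp [embedProp, hp, zigzag]
  rw [hidem] at h
  generalize f _ = b at h
  simp only [zigzag] at h
  have : b = 1 ∨ b = 3 := by omega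
  rcases this with rfl | rfl <;> simp [embedProp]

/-- Among pairs of a source and a sink, only `(0, 3)` is not an edge. -/
theorem zigzag_low_of_high (hf : (digraphStructure zigzag).IsPolymorphism f)
    (p q : Fin m → Prop) (hpq : ∀ i, q i → p i) (hq : f (fun i => embedProp 1 3 (q i)) = 3) :
    f (fun i => embedProp 0 2 (p i)) = 2 := by
  have h := isPolymorphism_digraph_iff.1 hf (fun i => embedProp 0 2 (p i))
    (fun i => embedProp 1 3 (q i)) fun i => by
      by_cases hp : p i
      · by_cases hq : q i <;> simp [embedProp, hp, hq, zigzag]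
      · simp [embedProp, hp, mt (hpq i) hp, zigzag]
  rw [hq] at h
  simp only [zigzag] at h
  omega

variable {A : Type u} {𝔸 : RelStructure A}

/-- An idempotent polymorphism of `𝔸` and an idempotent polymorphism of the zigzag. -/
noncomputable def IdempotentTriple.ofZigzag {g : (Fin m → A) → A} (hg : 𝔸.IsPolymorphism g)
    (hgi : ∀ a, g (fun _ => a) = a) (hf : (digraphStructure zigzag).IsPolymorphism f)
    (hfi : ∀ b, f (fun _ => b) = b) : IdempotentTriple 𝔸 m where
  f := g
  low p := f (fun i => embedProp 0 2 (p i)) = 2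
  high p := f (fun i => embedProp 1 3 (p i)) = 3
  isPolymorphism := hg
  f_const := hgi
  low_const p := by rw [hfi, embedProp_eq_iff (by decide)]
  high_const p := by rw [hfi, embedProp_eq_iff (by decide)]
  low_of_high := zigzag_low_of_high hf

/-- The unary identity operation. -/
def IdempotentTriple.unary (𝔸 : RelStructure A) : IdempotentTriple 𝔸 1 where
  f x := x 0
  low x := x 0
  high x := x 0
  isPolymorphism := isPolymorphism_proj 𝔸 0
  f_const _ := rfl
  low_const _ := rfl
  high_const _ := rfl
  low_of_high _ _ h := h 0

end Zigzag

/-! ### Linear identities in `𝒟(𝔸)` -/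

section Transfer

open FirstOrder Language

variable {A : Type u} {𝔸 : RelStructure A} {L : FirstOrder.Language.{v, w}} [L.IsAlgebraic]

theorem satisfies_of_toDigraph [Inhabited A] [Inhabited 𝔸.prodRel] {S : Set (Identity L)}
    (h : (digraphStructure 𝔸.toDigraph).Satisfies S) : 𝔸.Satisfies S := by
  obtain ⟨F, hF, hS⟩ := h
  let G : L.Structure A := { funMap := fun {_} f => restrict (F.funMap f) }
  refine ⟨G, fun m f => isPolymorphism_restrict (hF m f), fun e he => ?_⟩
  exact value_eq_of_injective (F := G) (G := F) (φ := DVertex.elem) (fun _ _ h => by injection h)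
    (fun m f y => elem_restrict (hF m f) y) (hS e he)

/-- Every finite set of at most two numbers containing `n` lies in a pair `{n, n'}`. -/
theorem exists_subset_pair {s : Finset ℕ} (hs : s.card ≤ 2) {n : ℕ} (hn : n ∈ s) :
    ∃ n', ∀ k ∈ s, k = n ∨ k = n' := by
  have : (s.erase n).card ≤ 1 := by
    rw [Finset.card_erase_of_mem hn]
    omega
  obtain ⟨n', hn'⟩ := Finset.card_le_one_iff_subset_singleton.1 this
  refine ⟨n', fun k hk => or_iff_not_imp_left.2 fun h => ?_⟩
  simpa using hn' (Finset.mem_erase.2 ⟨h, hk⟩)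

/-- The interpretation of the symbols by the given operations on `A`. -/
abbrev baseStructure (T : ∀ m, L.Functions m → IdempotentTriple 𝔸 m) : L.Structure A where
  funMap f := (T _ f).f

/-- The interpretation of the symbols by the operations on the sources of the zigzag. -/
abbrev lowStructure (T : ∀ m, L.Functions m → IdempotentTriple 𝔸 m) : L.Structure Prop where
  funMap f := (T _ f).low

/-- The interpretation of the symbols by the operations on the sinks of the zigzag. -/
abbrev highStructure (T : ∀ m, L.Functions m → IdempotentTriple 𝔸 m) : L.Structure Prop where
  funMap f := (T _ f).high

variable [Inhabited A] [Inhabited 𝔸.prodRel] [Finite A]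

/-- The interpretation of the symbols by the extended operations on `𝒟(𝔸)`. -/
noncomputable abbrev extendStructure (T : ∀ m, L.Functions m → IdempotentTriple 𝔸 m) :
    L.Structure (DVertex 𝔸) where
  funMap f := (T _ f).extend

/-- A bare variable is treated as the unary identity operation, which gives both sides of a linear
identity the same form. -/
theorem exists_operation_of_linear (T : ∀ m, L.Functions m → IdempotentTriple 𝔸 m)
    (hL : ∀ (m : ℕ), L.Functions m → m ≠ 0) {t : L.Term ℕ} (ht : opCount t ≤ 1) :
    ∃ (m : ℕ) (U : IdempotentTriple 𝔸 m) (σ : Fin m → ℕ),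
      m ≠ 0 ∧ (∀ n, n ∈ t.varFinset ↔ ∃ i, σ i = n) ∧
      (∀ x, value (baseStructure T) x t = U.f fun i => x (σ i)) ∧
      (∀ x, value (lowStructure T) x t = U.low fun i => x (σ i)) ∧
      (∀ x, value (highStructure T) x t = U.high fun i => x (σ i)) ∧
      ∀ x, value (extendStructure T) x t = U.extend fun i => x (σ i) := by
  rcases linear_term_cases ht with ⟨n, rfl⟩ | ⟨m, f, σ, rfl⟩
  · refine ⟨1, .unary 𝔸, fun _ => n, one_ne_zero, fun k => ?_, fun _ => rfl, fun _ => rfl,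
      fun _ => rfl, fun x => ?_⟩
    · simp [Term.varFinset, eq_comm]
    · exact ((IdempotentTriple.unary 𝔸).extend_const (x n)).symm
  · refine ⟨m, T m f, σ, hL m f, fun k => ?_, fun _ => rfl, fun _ => rfl, fun _ => rfl,
      fun _ => rfl⟩
    simp [Term.varFinset, eq_comm]

theorem extend_eq_of_absorption {m m' : ℕ} (T : IdempotentTriple 𝔸 m) (T' : IdempotentTriple 𝔸 m')
    {σ : Fin m → ℕ} {τ : Fin m' → ℕ} {n n' : ℕ} (hσ : ∀ i, σ i = n ∨ σ i = n')
    (hτ : ∀ i, τ i = n) (hf : ∀ x : ℕ → A, T.f (fun i => x (σ i)) = T'.f fun i => x (τ i))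
    (hlow : ∀ x : ℕ → Prop, T.low (fun i => x (σ i)) = T'.low fun i => x (τ i))
    (hhigh : ∀ x : ℕ → Prop, T.high (fun i => x (σ i)) = T'.high fun i => x (τ i))
    (x : ℕ → DVertex 𝔸) : T.extend (fun i => x (σ i)) = T'.extend fun i => x (τ i) := by
  simp only [hτ, T'.f_const, T'.low_const, T'.high_const, T'.extend_const] at hf hlow hhigh ⊢
  exact T.extend_eq_of_subset_pair (y := x n')
    (fun i => (hσ i).imp (fun h => by rw [h]) fun h => by rw [h])
    (fun φ => hf fun k => φ (x k)) (fun φ => hlow fun k => φ (x k)) fun φ => hhigh fun k => φ (x k)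

theorem extendStructure_value_eq (T : ∀ m, L.Functions m → IdempotentTriple 𝔸 m)
    (hL : ∀ (m : ℕ), L.Functions m → m ≠ 0) {e : Identity L} (hlin : IsLinear e)
    (hbal : IsBalanced e ∨ AtMostTwoVariables e)
    (hf : ∀ x, value (baseStructure T) x e.1 = value (baseStructure T) x e.2)
    (hlow : ∀ x, value (lowStructure T) x e.1 = value (lowStructure T) x e.2)
    (hhigh : ∀ x, value (highStructure T) x e.1 = value (highStructure T) x e.2)
    (x : ℕ → DVertex 𝔸) :
    value (extendStructure T) x e.1 = value (extendStructure T) x e.2 := by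
  obtain ⟨m, U, σ, hm, hσ, hU₁, hU₂, hU₃, hU₄⟩ := exists_operation_of_linear T hL hlin.1
  obtain ⟨m', U', τ, hm', hτ, hU₁', hU₂', hU₃', hU₄'⟩ := exists_operation_of_linear T hL hlin.2
  simp only [hU₁, hU₂, hU₃, hU₁', hU₂', hU₃'] at hf hlow hhigh
  rw [hU₄, hU₄']
  by_cases hb : e.1.varFinset = e.2.varFinset
  · refine U.extend_eq_of_range_eq U' ?_ (fun φ => hf fun k => φ (x k))
      (fun φ => hlow fun k => φ (x k)) fun φ => hhigh fun k => φ (x k)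
    have : Set.range σ = Set.range τ := by
      ext n
      rw [Set.mem_range, Set.mem_range, ← hσ, ← hτ, hb]
    rw [show (fun i => x (σ i)) = x ∘ σ from rfl, show (fun i => x (τ i)) = x ∘ τ from rfl,
      Set.range_comp, Set.range_comp, this]
  · have hcard : (e.1.varFinset ∪ e.2.varFinset).card ≤ 2 := hbal.resolve_left hb
    -- A side with two variables contains all of them, so in an unbalanced identity some side has
    -- only one; by idempotence that side reduces to the variable.
    have hsub : ∀ {s : Finset ℕ}, s ⊆ e.1.varFinset ∪ e.2.varFinset → 2 ≤ s.card →
        s = e.1.varFinset ∪ e.2.varFinset := fun h h' =>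
      Finset.eq_of_subset_of_card_le h (hcard.trans h')
    by_cases h₂ : 2 ≤ e.2.varFinset.card
    · have h₁ : ¬ 2 ≤ e.1.varFinset.card := fun h₁ => hb <|
        (hsub Finset.subset_union_left h₁).trans (hsub Finset.subset_union_right h₂).symm
      let i₀ : Fin m := ⟨0, Nat.pos_of_ne_zero hm⟩
      obtain ⟨n', hn'⟩ := exists_subset_pair hcard
        (Finset.mem_union_left _ ((hσ (σ i₀)).2 ⟨i₀, rfl⟩))
      refine (extend_eq_of_absorption U' U (n := σ i₀) (n' := n')
        (fun i => hn' _ (Finset.mem_union_right _ ((hτ _).2 ⟨i, rfl⟩)))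
        (fun i => Finset.card_le_one.1 (by omega) _ ((hσ _).2 ⟨i, rfl⟩) _ ((hσ _).2 ⟨i₀, rfl⟩))
        (fun x => (hf x).symm) (fun x => (hlow x).symm) (fun x => (hhigh x).symm) x).symm
    · let i₀ : Fin m' := ⟨0, Nat.pos_of_ne_zero hm'⟩
      obtain ⟨n', hn'⟩ := exists_subset_pair hcard
        (Finset.mem_union_right _ ((hτ (τ i₀)).2 ⟨i₀, rfl⟩))
      exact extend_eq_of_absorption U U' (n := τ i₀) (n' := n')
        (fun i => hn' _ (Finset.mem_union_left _ ((hσ _).2 ⟨i, rfl⟩)))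
        (fun i => Finset.card_le_one.1 (by omega) _ ((hτ _).2 ⟨i, rfl⟩) _ ((hτ _).2 ⟨i₀, rfl⟩))
        hf hlow hhigh x

theorem satisfies_toDigraph {S : Set (Identity L)} (hlin : ∀ e ∈ S, IsLinear e)
    (hidem : IsIdempotentSet S) (hzig : (digraphStructure zigzag).Satisfies S)
    (hbal : ∀ e ∈ S, IsBalanced e ∨ AtMostTwoVariables e) (h : 𝔸.Satisfies S) :
    (digraphStructure 𝔸.toDigraph).Satisfies S := by
  have hL : ∀ m, L.Functions m → m ≠ 0 := fun _ => arity_ne_zero hzig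
  obtain ⟨F, hF, hFi, hFS⟩ := h.exists_idempotent hL hidem
  obtain ⟨Z, hZ, hZi, hZS⟩ := hzig.exists_idempotent hL hidem
  let T : ∀ m, L.Functions m → IdempotentTriple 𝔸 m := fun m f =>
    .ofZigzag (hF m f) (hFi m f) (hZ m f) (hZi m f)
  refine ⟨extendStructure T, fun m f => isPolymorphism_digraph_iff.2 fun t t' h =>
    (T m f).adj_extend (hL m f) h, fun e he =>
    extendStructure_value_eq T hL (hlin e he) (hbal e he) ?_ ?_ ?_⟩
  · exact value_eq_of_injective (F := baseStructure T) (G := F) (φ := id) Function.injective_id (fun _ _ _ => rfl) (hFS e he)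
  · exact value_eq_of_injective (embedProp_injective (b := (0 : Fin 4)) (c := 2) (by decide))
      (fun m f => zigzag_low (hZ m f) (hZi m f)) (hZS e he)
  · exact value_eq_of_injective (embedProp_injective (b := (1 : Fin 4)) (c := 3) (by decide))
      (fun m f => zigzag_high (hZ m f) (hZi m f)) (hZS e he)

end Transfer

theorem subsingleton_dVertex {A : Type u} [IsEmpty A] (𝔸 : RelStructure A) :
    Subsingleton (DVertex 𝔸) := by
  constructor
  rintro (a | r | ⟨a, _, _⟩) y
  · exact isEmptyElim a
  · rcases y with b | s | ⟨b, _, _⟩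
    · exact (IsEmpty.false b).elim
    · rw [Subsingleton.elim r s]
    · exact (IsEmpty.false b).elim
  · exact (IsEmpty.false a).elim

end DigraphReduction

theorem theorem5p1 {A : Type u} [Finite A] (𝔸 : DigraphReduction.RelStructure A)
    (hne : ∀ i, (𝔸.rel i).Nonempty)
    {L : FirstOrder.Language.{v, w}} [L.IsAlgebraic] (S : Set (DigraphReduction.Identity L))
    (hlin : ∀ e ∈ S, DigraphReduction.IsLinear e)
    (hidem : DigraphReduction.IsIdempotentSet S)
    (hzig : (DigraphReduction.digraphStructure DigraphReduction.zigzag).Satisfies S)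
    (hbal : ∀ e ∈ S, DigraphReduction.IsBalanced e ∨ DigraphReduction.AtMostTwoVariables e) :
    𝔸.Satisfies S ↔ (DigraphReduction.digraphStructure 𝔸.toDigraph).Satisfies S := by
  rcases isEmpty_or_nonempty A with hA | ⟨⟨a⟩⟩
  · have hL : ∀ m, L.Functions m → m ≠ 0 := fun _ => DigraphReduction.arity_ne_zero hzig
    have := DigraphReduction.subsingleton_dVertex 𝔸
    exact iff_of_true (DigraphReduction.satisfies_of_subsingleton _ hL S)
      (DigraphReduction.satisfies_of_subsingleton _ hL S)
  · obtain ⟨r⟩ := DigraphReduction.nonempty_prodRel hne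
    let _ : Inhabited A := ⟨a⟩
    let _ : Inhabited 𝔸.prodRel := ⟨r⟩
    exact ⟨DigraphReduction.satisfies_toDigraph hlin hidem hzig hbal,
      DigraphReduction.satisfies_of_toDigraph⟩
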